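/- For a positive integer $n$ and $x=x_1\cdots x_n\in\{0,1\}^n$ let $\mathrm{OMB}_n(x)=k \bmod 2$ (ODD-MAX-BIT), where $k$ is the largest index with $x_k=1$, and $k=0$ if $x=0^n$. A quantum query algorithm with $T$ queries applies $U_TO_xU_{T-1}O_x\cdots O_xU_0$ to a fixed basis state $|i_0,b_0,z_0\rangle$, where the $U_j$ are unitaries that do not depend on $x$, the workspace register $z$ has any finite dimension, and $O_x|i,b,z\rangle=|i,b\oplus x_i,z\rangle$ with $i\in\{1,\dots,n\}$, $b\in\{0,1\}$; it then measures in the computational basis and outputs a bit determined by the outcome. Its success probability $p$ for $f:\{0,1\}^n\to\{0,1\}$ is the minimum over all $x\in\{0,1\}^n$ of the probability that it outputs $f(x)$. Let $\mathrm{UQ}(f)$ be the minimum of $T$ over all algorithms with $p>1/2$ (the unbounded error quantum query complexity), and let $\mathrm{WUQ}(f)$ be the infimum over all algorithms with $p>1/2$ of the cost $T+\log_2\frac{1}{2\beta}$, where $\beta=p-1/2$ (the weakly unbounded error quantum query complexity). Lemma. $\mathrm{UQ}(\mathrm{OMB}_n)=1$ for every $n\ge 1$, and $\mathrm{WUQ}(\mathrm{OMB}_n)=\Omega(n^{1/3}/\log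 n)$; that is, there is a constant $c>0$ such that $\mathrm{WUQ}(\mathrm{OMB}_n)\ge c\,n^{1/3}/\log_2 n$ for all $n\ge 2$. -/

import Mathlib

noncomputable section

/-- Computational basis states `|i, b, z⟩` of a quantum query algorithm on `n` input bits: an index
register `i`, a one-bit answer register `b`, and a finite-dimensional workspace `z`. -/
abbrev QueryBasis (n m : ℕ) : Type := Fin n × Bool × Fin m

/-- The black box holding `x`: the unitary `|i, b, z⟩ ↦ |i, b ⊕ x_i, z⟩`, acting on the amplitude
vector `ψ`. This permutation of the basis states is its own inverse. -/
def queryOracle {n m : ℕ} (x : Fin n → Bool) (ψ : QueryBasis n m → ℂ) : QueryBasis n m → ℂ :=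
  fun s => ψ (s.1, xor s.2.1 (x s.1), s.2.2)

/-- A quantum query algorithm on `n` input bits. It starts in a fixed basis state, applies
`U_T O_x U_{T-1} ⋯ O_x U_0`, where `T` is the number of queries, measures in the computational
basis, and outputs a bit computed from the measurement result. (Only `unitary 0, …, unitary T`
are used.) -/
structure QuantumQueryAlgorithm (n : ℕ) where
  /-- dimension of the workspace -/
  workDim : ℕ
  /-- number of queries -/
  queries : ℕ
  /-- initial basis state -/
  start : QueryBasis n workDim
  /-- input-independent unitaries -/
  unitary : ℕ → Matrix.unitaryGroup (QueryBasis n workDim) ℂ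
  /-- the output bit, as a function of the measured basis state -/
  output : QueryBasis n workDim → Bool

namespace QuantumQueryAlgorithm

variable {n : ℕ}

/-- Amplitude vector on input `x` after `t` queries (and the unitary that follows them). -/
def state (A : QuantumQueryAlgorithm n) (x : Fin n → Bool) : ℕ → QueryBasis n A.workDim → ℂ
  | 0 => (A.unitary 0).1.mulVec (Pi.single A.start 1)
  | t + 1 => (A.unitary (t + 1)).1.mulVec (queryOracle x (A.state x t))

/-- Probability that `A` outputs the bit `c` on input `x`. -/
def outputProb (A : QuantumQueryAlgorithm n) (x : Fin n → Bool) (c : Bool) : ℝ :=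
  ∑ s : QueryBasis n A.workDim, if A.output s = c then ‖A.state x A.queries s‖ ^ 2 else 0

/-- Success probability of `A` for computing `f`, in the worst case over all inputs. -/
def successProb (A : QuantumQueryAlgorithm n) (f : (Fin n → Bool) → Bool) : ℝ :=
  ⨅ x : Fin n → Bool, A.outputProb x (f x)

/-- The bias `β = p - 1/2`, where `p` is the success probability. -/
def bias (A : QuantumQueryAlgorithm n) (f : (Fin n → Bool) → Bool) : ℝ :=
  A.successProb f - 1 / 2

/-- The weakly unbounded cost: number of queries plus `log₂ (1 / (2 β))`. -/
def weaklyUnboundedCost (A : QuantumQueryAlgorithm n) (f : (Fin n → Bool) → Bool) : ℝ :=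
  (A.queries : ℝ) + Real.logb 2 (1 / (2 * A.bias f))

end QuantumQueryAlgorithm

/-- Unbounded error quantum query complexity: the least number of queries of an algorithm that
computes `f` with success probability greater than `1/2` on every input. -/
def UQ {n : ℕ} (f : (Fin n → Bool) → Bool) : ℕ :=
  sInf {T | ∃ A : QuantumQueryAlgorithm n, A.queries = T ∧ 1 / 2 < A.successProb f}

/-- Weakly unbounded error quantum query complexity: the least weakly unbounded cost of an
algorithm that computes `f` with success probability greater than `1/2` on every input. -/
def WUQ {n : ℕ} (f : (Fin n → Bool) → Bool) : ℝ :=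
  sInf {r | ∃ A : QuantumQueryAlgorithm n, 1 / 2 < A.successProb f ∧ A.weaklyUnboundedCost f = r}

/-- The largest position `k ∈ {1, …, n}` with `x_k = 1`, and `0` if there is none. The bit `x_k` is
`x i` for the `i : Fin n` with `i + 1 = k`. -/
def maxOnePosition {n : ℕ} (x : Fin n → Bool) : ℕ :=
  (Finset.univ.filter fun i : Fin n => x i = true).sup fun i => (i : ℕ) + 1

/-- The function ODD-MAX-BIT on `n` bits. -/
def OMB (n : ℕ) (x : Fin n → Bool) : Bool :=
  decide (maxOnePosition x % 2 = 1)

end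

/-!
One query suffices for ODD-MAX-BIT because it is a weighted majority vote: weights `3 ^ i` make the
last one outweigh all smaller indices, so querying a random index drawn with these weights is right
with probability above `1/2` (`exists_one_query_algorithm`). No query is not enough, since
then the output does not depend on the input (`queries_pos`).

For the lower bound, the acceptance probability of an algorithm with `T` queries is a polynomial of
degree at most `d = 2 * T` in the input bits (`outputProb_mem_lowDegree`). Subtracting `1/2` gives a
function `f` with `|f| ≤ 1/2` that sign-represents ODD-MAX-BIT with margin the bias `β`. As in
Beigel's argument for perceptrons, such an `f` grows: cut the indices into intervals of length
`O(d ^ 2)`, and let `y` vanish from some interval on. Setting any bits of the interval that have the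
appropriate parity flips the sign of `f`. Averaging over the choices of `k` such bits produces a
univariate polynomial in `k` of degree at most `d` (`exists_symmetrization`) that jumps across `0`
between `k = 0` and `k = 1` and does not change sign again on the `Ω(d ^ 2)` following integers.
Such a polynomial must overshoot the jump by a constant factor (`exists_two_mul_le_eval`), so some
choice of the bits at least doubles `|f|`. Over all intervals this yields
`2 ^ Ω(n / T ^ 2) * β ≤ 1/2` (`two_pow_mul_bias_le`), so the cost
`T + log₂ (1 / (2 β))` is at least of order `T + n / T ^ 2`, hence at least of order `n ^ (1 / 3)`.

The overshooting is usually derived from Markov's inequality for derivatives. Here it follows from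
Lagrange interpolation at the nodes `1` and `16 * j ^ 2`, `1 ≤ j ≤ d`, evaluated at `0`.
-/

namespace OddMaxBit
open Finset Polynomial

/-! ### Polynomials that jump across zero -/

/-- Up to a sign, this product is the value at `0` of the Lagrange basis polynomial of the node
`(j + 1) ^ 2` among the nodes `1, 4, …, (j + 1 + e) ^ 2`. -/
lemma prod_sq_div_eq (j e : ℕ) :
    ∏ i ∈ (Icc 1 (j + 1 + e)).erase (j + 1), ((i : ℝ) ^ 2 / |(i : ℝ) ^ 2 - ((j + 1 : ℕ) : ℝ) ^ 2|)
      = 2 * ((j + 1 + e).factorial : ℝ) ^ 2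
        / ((e.factorial : ℝ) * ((2 * (j + 1) + e).factorial : ℝ)) := by
  induction e with
  | zero =>
    have h1 : (Icc 1 (j + 1 + 0)).erase (j + 1) = (range j).image (· + 1) := by
      ext i
      simp only [mem_erase, mem_Icc, mem_image, mem_range]
      constructor
      · rintro ⟨h, h', h''⟩
        exact ⟨i - 1, by omega, by omega⟩
      · rintro ⟨a, h, rfl⟩
        omega
    rw [h1, prod_image (by intro a _ b _ h; simpa using h)]
    have h2 : ∀ i ∈ range j, (((i + 1 : ℕ) : ℝ) ^ 2 / |((i + 1 : ℕ) : ℝ) ^ 2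
        - ((j + 1 : ℕ) : ℝ) ^ 2|)
        = ((i + 1 : ℕ) : ℝ) ^ 2 / (((j - i : ℕ) : ℝ) * ((j + 2 + i : ℕ) : ℝ)) := by
      intro i hi
      have hi' : i < j := mem_range.1 hi
      have hi2 : (i : ℝ) < j := by exact_mod_cast hi'
      congr 1
      rw [abs_of_nonpos (by push_cast; nlinarith [(Nat.cast_nonneg i : (0 : ℝ) ≤ i)]),
        Nat.cast_sub hi'.le]
      push_cast
      ring
    rw [prod_congr rfl h2, prod_div_distrib, prod_mul_distrib, prod_pow, ← Nat.cast_prod,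
      ← Nat.cast_prod, ← Nat.cast_prod, Finset.prod_range_add_one_eq_factorial,
      ← Nat.descFactorial_eq_prod_range, Nat.descFactorial_self,
      ← Nat.ascFactorial_eq_prod_range]
    have h3 : (((j + 1).factorial * (j + 2).ascFactorial j : ℕ) : ℝ)
        = ((j + 1 + j).factorial : ℕ) := by
      rw [Nat.factorial_mul_ascFactorial]
    have h4 : ((2 * (j + 1) + 0).factorial) = (2 * (j + 1)) * (j + 1 + j).factorial := by
      rw [show 2 * (j + 1) + 0 = (j + 1 + j) + 1 by ring, Nat.factorial_succ]
      ring
    rw [h4, Nat.cast_mul, ← h3]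
    simp only [Nat.factorial_succ, add_zero, Nat.factorial_zero]
    have : (0 : ℝ) < j.factorial := by exact_mod_cast j.factorial_pos
    have : (0 : ℝ) < (j + 2).ascFactorial j := by
      exact_mod_cast Nat.ascFactorial_pos (j + 1) j
    push_cast
    field_simp
  | succ e ih =>
    have h1 : (Icc 1 (j + 1 + (e + 1))).erase (j + 1)
        = insert (j + 1 + (e + 1)) ((Icc 1 (j + 1 + e)).erase (j + 1)) := by
      ext i
      simp only [mem_erase, mem_Icc, mem_insert]
      omega
    rw [h1, prod_insert (by simp), ih]
    have h2 : |((j + 1 + (e + 1) : ℕ) : ℝ) ^ 2 - ((j + 1 : ℕ) : ℝ) ^ 2|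
        = ((e : ℝ) + 1) * (2 * (j + 1) + e + 1) := by
      rw [abs_of_nonneg (by push_cast; nlinarith [(Nat.cast_nonneg j : (0 : ℝ) ≤ j),
        (Nat.cast_nonneg e : (0 : ℝ) ≤ e)])]
      push_cast
      ring
    rw [h2, ← add_assoc, ← add_assoc, Nat.factorial_succ (j + 1 + e), Nat.factorial_succ e,
      Nat.factorial_succ (2 * (j + 1) + e)]
    have : (0 : ℝ) < e.factorial := by exact_mod_cast e.factorial_pos
    have : (0 : ℝ) < (2 * (j + 1) + e).factorial := by exact_mod_cast Nat.factorial_pos _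
    push_cast
    field_simp

lemma prod_sq_div_le (d j : ℕ) (hj : j ∈ Icc 1 d) :
    ∏ i ∈ (Icc 1 d).erase j, ((i : ℝ) ^ 2 / |(i : ℝ) ^ 2 - (j : ℝ) ^ 2|) ≤ 2 := by
  obtain ⟨h1, h2⟩ := mem_Icc.1 hj
  obtain ⟨j, rfl⟩ := Nat.exists_eq_add_of_le' h1
  obtain ⟨e, rfl⟩ := Nat.exists_eq_add_of_le h2
  rw [prod_sq_div_eq, div_le_iff₀ (by positivity)]
  have : (j + 1 + e).factorial ^ 2 ≤ e.factorial * (2 * (j + 1) + e).factorial := by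
    have h3 : (j + 1 + e).factorial = e.factorial * (e + 1).ascFactorial (j + 1) := by
      rw [Nat.factorial_mul_ascFactorial, add_comm]
    have h4 : (2 * (j + 1) + e).factorial
        = (j + 1 + e).factorial * (j + 1 + e + 1).ascFactorial (j + 1) := by
      rw [Nat.factorial_mul_ascFactorial]
      congr 1
      ring
    rw [h4, sq]
    nth_rw 1 [h3]
    have h5 : (e + 1).ascFactorial (j + 1) ≤ (j + 1 + e + 1).ascFactorial (j + 1) := by
      rw [Nat.ascFactorial_eq_prod_range, Nat.ascFactorial_eq_prod_range]
      exact prod_le_prod' fun i _ => by omega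
    calc _ = e.factorial * (j + 1 + e).factorial * (e + 1).ascFactorial (j + 1) := by ring
      _ ≤ e.factorial * (j + 1 + e).factorial * (j + 1 + e + 1).ascFactorial (j + 1) :=
        Nat.mul_le_mul_left _ h5
      _ = _ := by ring
  have h : ((j + 1 + e).factorial : ℝ) ^ 2 ≤ e.factorial * (2 * (j + 1) + e).factorial := by
    exact_mod_cast this
  linarith

lemma sum_four_div_le (d : ℕ) : ∑ j ∈ Icc 1 d, 4 / (16 * (j : ℝ) ^ 2 - 1) ≤ 1 / 2 := by
  suffices h : ∑ j ∈ Icc 1 d, 4 / (16 * (j : ℝ) ^ 2 - 1) ≤ 1 / 2 - 1 / (2 * (2 * (d : ℝ) + 1)) by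
    have : (0 : ℝ) ≤ 1 / (2 * (2 * (d : ℝ) + 1)) := by positivity
    linarith
  induction d with
  | zero => norm_num
  | succ d ih =>
    rw [sum_Icc_succ_top (by omega)]
    have hd : (0 : ℝ) ≤ d := Nat.cast_nonneg d
    have h1 : 4 / (16 * ((d + 1 : ℕ) : ℝ) ^ 2 - 1) ≤
        1 / (2 * (2 * (d : ℝ) + 1)) - 1 / (2 * (2 * ((d + 1 : ℕ) : ℝ) + 1)) := by
      push_cast
      rw [div_sub_div _ _ (by positivity) (by positivity),
        div_le_div_iff₀ (by nlinarith) (by positivity)]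
      nlinarith
    linarith

/-- A polynomial of degree at most `d` that jumps from `-M` at `0` to nonnegative values at
`1, …, 16 * d ^ 2 + 1` must overshoot: it reaches `2 * M` at one of these points. Otherwise Lagrange
interpolation at the nodes `1, 16, 64, …, 16 * d ^ 2` would give a value above `-M` at `0`: the
basis polynomial of the node `1` is positive there, so it contributes nonnegatively, and those of
the nodes `16 * j ^ 2` are too small there to contribute `-M` in total. -/
theorem exists_two_mul_le_eval {d : ℕ} (P : ℝ[X]) (hd : P.natDegree ≤ d) {M : ℝ} (hM : 0 < M)
    (h0 : P.eval 0 = -M) (hpos : ∀ k : ℕ, 1 ≤ k → k ≤ 16 * d ^ 2 + 1 → 0 ≤ P.eval (k : ℝ)) :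
    ∃ k : ℕ, 1 ≤ k ∧ k ≤ 16 * d ^ 2 + 1 ∧ 2 * M ≤ P.eval (k : ℝ) := by
  by_contra! hlt
  -- interpolation nodes: `1` (as index `0`) and `16 j²` for `1 ≤ j ≤ d`
  set v : ℕ → ℝ := fun j => if j = 0 then 1 else 16 * (j : ℝ) ^ 2 with hv
  have v0 : v 0 = 1 := by simp [hv]
  have vj : ∀ j, 1 ≤ j → v j = 16 * (j : ℝ) ^ 2 := fun j hj => by
    simp [hv, Nat.one_le_iff_ne_zero.1 hj]
  have sq1 : ∀ j : ℕ, 1 ≤ j → (1 : ℝ) ≤ (j : ℝ) ^ 2 := fun j hj => by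
    exact_mod_cast Nat.one_le_pow 2 j hj
  have hinj : Set.InjOn v (range (d + 1)) := by
    intro a _ b _ hab
    rcases Nat.eq_zero_or_pos a with rfl | ha <;> rcases Nat.eq_zero_or_pos b with rfl | hb
    · rfl
    · rw [v0, vj b hb] at hab; nlinarith [sq1 b hb]
    · rw [v0, vj a ha] at hab; nlinarith [sq1 a ha]
    · rw [vj a ha, vj b hb] at hab
      have : (a : ℝ) ^ 2 = (b : ℝ) ^ 2 := by linarith
      exact_mod_cast (sq_eq_sq₀ (Nat.cast_nonneg a) (Nat.cast_nonneg b)).1 this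
  have hdeg : P.degree < #(range (d + 1)) := by
    rw [card_range]
    exact lt_of_le_of_lt degree_le_natDegree (by exact_mod_cast Nat.lt_succ_of_le hd)
  have hint := congrArg (Polynomial.eval 0) (Lagrange.eq_interpolate hinj hdeg)
  rw [Lagrange.interpolate_apply, eval_finsetSum, h0] at hint
  have hbasis : ∀ j, (Lagrange.basis (range (d + 1)) v j).eval 0
      = ∏ i ∈ (range (d + 1)).erase j, v i / (v i - v j) := by
    intro j
    rw [Lagrange.basis, eval_prod]
    refine prod_congr rfl fun i _ => ?_
    rw [Lagrange.basisDivisor]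
    simp only [eval_mul, eval_C, eval_sub, eval_X, zero_sub]
    rw [← neg_sub (v i) (v j), inv_neg, div_eq_inv_mul]
    ring
  simp only [eval_mul, eval_C, hbasis] at hint
  have hr : range (d + 1) = insert 0 (Icc 1 d) := by
    ext i
    simp only [mem_range, mem_insert, mem_Icc]
    omega
  have h0m : 0 ∉ Icc 1 d := by simp
  rw [hr, sum_insert h0m] at hint
  -- the node `1` helps: its basis polynomial is positive at `0`
  have hT0 : 0 ≤ P.eval (v 0) * ∏ i ∈ (insert 0 (Icc 1 d)).erase 0, v i / (v i - v 0) := by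
    refine mul_nonneg ?_ (prod_nonneg fun i hi => ?_)
    · have := hpos 1 le_rfl (by omega)
      rwa [v0, ← Nat.cast_one]
    · rw [erase_insert h0m] at hi
      have hi1 := (mem_Icc.1 hi).1
      have := sq1 i hi1
      rw [v0, vj i hi1]
      apply div_nonneg <;> linarith
  have hTj : ∀ j ∈ Icc 1 d, -(4 / (16 * (j : ℝ) ^ 2 - 1) * M)
      ≤ P.eval (v j) * ∏ i ∈ (insert 0 (Icc 1 d)).erase j, v i / (v i - v j) := by
    intro j hj
    obtain ⟨hj1, hjd⟩ := mem_Icc.1 hj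
    have hsq := sq1 j hj1
    have hle : 16 * j ^ 2 ≤ 16 * d ^ 2 + 1 := by
      have := Nat.pow_le_pow_left hjd 2
      omega
    have hge : 1 ≤ 16 * j ^ 2 := by
      have := Nat.one_le_pow 2 j hj1
      omega
    have hcast : v j = ((16 * j ^ 2 : ℕ) : ℝ) := by rw [vj j hj1]; push_cast; ring
    have hPv0 : 0 ≤ P.eval (v j) := by rw [hcast]; exact hpos _ hge hle
    have hPv1 : P.eval (v j) ≤ 2 * M := by rw [hcast]; exact (hlt _ hge hle).le
    -- the closeness of the node `1` to `0` yields the factor `1 / (16 j² - 1)`, hence summability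
    have habs : |∏ i ∈ (insert 0 (Icc 1 d)).erase j, v i / (v i - v j)|
        ≤ 2 / (16 * (j : ℝ) ^ 2 - 1) := by
      rw [erase_insert_of_ne (by omega), prod_insert (by simp), abs_mul, abs_prod, v0, vj j hj1,
        abs_div, abs_one, abs_of_nonpos (by linarith : 1 - 16 * (j : ℝ) ^ 2 ≤ 0), neg_sub]
      have hcongr : ∏ i ∈ (Icc 1 d).erase j, |v i / (v i - 16 * (j : ℝ) ^ 2)|
          = ∏ i ∈ (Icc 1 d).erase j, ((i : ℝ) ^ 2 / |(i : ℝ) ^ 2 - (j : ℝ) ^ 2|) := by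
        refine prod_congr rfl fun i hi => ?_
        rw [vj i (mem_Icc.1 (mem_of_mem_erase hi)).1, ← mul_sub, abs_div, abs_mul, abs_mul,
          mul_div_mul_left _ _ (by norm_num), abs_of_nonneg (sq_nonneg (i : ℝ))]
      rw [hcongr, div_eq_mul_one_div 2, mul_comm]
      exact mul_le_mul_of_nonneg_right (prod_sq_div_le d j hj)
        (div_nonneg zero_le_one (by linarith))
    have h1 := neg_abs_le (P.eval (v j) * ∏ i ∈ (insert 0 (Icc 1 d)).erase j, v i / (v i - v j))
    rw [abs_mul, abs_of_nonneg hPv0] at h1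
    have h2 := mul_le_mul hPv1 habs (abs_nonneg _) (by linarith)
    calc _ = -(2 * M * (2 / (16 * (j : ℝ) ^ 2 - 1))) := by ring
      _ ≤ _ := by linarith
  have hsum := sum_le_sum hTj
  rw [sum_neg_distrib, ← sum_mul] at hsum
  have := mul_le_mul_of_nonneg_right (sum_four_div_le d) hM.le
  linarith

/-! ### Low-degree functions on the Boolean cube and symmetrization -/

section LowDegree

variable {n : ℕ} {K : Type*} [Field K]

/-- The multilinear monomial `∏ i ∈ s, x i`, as a function on Boolean vectors. -/
def monomialFn (K : Type*) [Field K] {n : ℕ} (s : Finset (Fin n)) : (Fin n → Bool) → K :=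
  fun x => if ∀ i ∈ s, x i = true then 1 else 0

/-- The functions on the Boolean cube that are polynomials of degree at most `d` in the input bits:
the span of the multilinear monomials with at most `d` factors. -/
def lowDegree (K : Type*) [Field K] (n d : ℕ) : Submodule K ((Fin n → Bool) → K) :=
  Submodule.span K (monomialFn K '' {s | #s ≤ d})

lemma monomialFn_mem {d : ℕ} {s : Finset (Fin n)} (hs : #s ≤ d) :
    monomialFn K s ∈ lowDegree K n d :=
  Submodule.subset_span ⟨s, hs, rfl⟩

lemma lowDegree_mono {d e : ℕ} (h : d ≤ e) : lowDegree K n d ≤ lowDegree K n e :=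
  Submodule.span_mono (Set.image_mono fun _ hs => le_trans hs h)

lemma monomialFn_mul (s t : Finset (Fin n)) :
    monomialFn K s * monomialFn K t = monomialFn K (s ∪ t) := by
  funext x
  have h : (∀ i ∈ s ∪ t, x i = true) ↔ (∀ i ∈ s, x i = true) ∧ ∀ i ∈ t, x i = true := by
    simp only [mem_union, or_imp, forall_and]
  simp only [monomialFn, Pi.mul_apply, h, ite_and, ite_mul, one_mul, zero_mul]

lemma mul_mem_lowDegree {d e : ℕ} {f g : (Fin n → Bool) → K} (hf : f ∈ lowDegree K n d)
    (hg : g ∈ lowDegree K n e) : f * g ∈ lowDegree K n (d + e) := by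
  have h := Submodule.mul_mem_mul hf hg
  rw [lowDegree, lowDegree, Submodule.span_mul_span] at h
  refine Submodule.span_mono ?_ h
  rintro _ ⟨_, ⟨s, hs, rfl⟩, _, ⟨t, ht, rfl⟩, rfl⟩
  exact ⟨s ∪ t, (card_union_le s t).trans (Nat.add_le_add hs ht), (monomialFn_mul s t).symm⟩

lemma const_mem_lowDegree (d : ℕ) (c : K) : (fun _ => c) ∈ lowDegree K n d := by
  convert (lowDegree K n d).smul_mem c (monomialFn_mem (s := ∅) (by simp)) using 1
  funext x
  simp [monomialFn]

lemma coord_mem_lowDegree (i : Fin n) : (fun x => if x i = true then (1 : K) else 0) ∈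
    lowDegree K n 1 := by
  convert monomialFn_mem (K := K) (s := {i}) (d := 1) (by simp) using 1
  funext x
  simp [monomialFn]

lemma re_im_mem_lowDegree {d : ℕ} {f : (Fin n → Bool) → ℂ} (hf : f ∈ lowDegree ℂ n d) :
    (fun x => (f x).re) ∈ lowDegree ℝ n d ∧ (fun x => (f x).im) ∈ lowDegree ℝ n d := by
  induction hf using Submodule.span_induction with
  | mem f h =>
    obtain ⟨s, hs, rfl⟩ := h
    constructor
    · convert monomialFn_mem (K := ℝ) hs using 1
      funext x
      simp only [monomialFn]
      split_ifs <;> simp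
    · convert (lowDegree ℝ n d).zero_mem using 1
      funext x
      simp only [monomialFn]
      split_ifs <;> simp
  | zero => exact ⟨(lowDegree ℝ n d).zero_mem, (lowDegree ℝ n d).zero_mem⟩
  | add f g _ _ hf hg =>
    exact ⟨(lowDegree ℝ n d).add_mem hf.1 hg.1, (lowDegree ℝ n d).add_mem hf.2 hg.2⟩
  | smul c f _ hf =>
    constructor
    · convert (lowDegree ℝ n d).sub_mem ((lowDegree ℝ n d).smul_mem c.re hf.1)
        ((lowDegree ℝ n d).smul_mem c.im hf.2) using 1
      funext x
      simp
    · convert (lowDegree ℝ n d).add_mem ((lowDegree ℝ n d).smul_mem c.re hf.2)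
        ((lowDegree ℝ n d).smul_mem c.im hf.1) using 1
      funext x
      simp

lemma norm_sq_mem_lowDegree {d : ℕ} {f : (Fin n → Bool) → ℂ} (hf : f ∈ lowDegree ℂ n d) :
    (fun x => ‖f x‖ ^ 2) ∈ lowDegree ℝ n (2 * d) := by
  obtain ⟨h1, h2⟩ := re_im_mem_lowDegree hf
  rw [two_mul]
  convert (lowDegree ℝ n (d + d)).add_mem (mul_mem_lowDegree h1 h1)
    (mul_mem_lowDegree h2 h2) using 1
  funext x
  rw [← Complex.normSq_eq_norm_sq, Complex.normSq_apply]
  rfl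

/-- `setOnes y S` is `y` with the bits in `S` changed to `1`. -/
def setOnes (y : Fin n → Bool) (S : Finset (Fin n)) : Fin n → Bool :=
  fun i => if i ∈ S then true else y i

/-- Minsky–Papert symmetrization: the average of a function of degree at most `d` over the ways of
setting `k` bits of `B` to `1` is a polynomial in `k` of degree at most `d`. -/
theorem exists_symmetrization {d : ℕ} {f : (Fin n → Bool) → ℝ} (hf : f ∈ lowDegree ℝ n d)
    (y : Fin n → Bool) (B : Finset (Fin n)) :
    ∃ P : ℝ[X], P.natDegree ≤ d ∧ ∀ k ≤ #B,
      ∑ S ∈ powersetCard k B, f (setOnes y S) = (#B).choose k * P.eval (k : ℝ) := by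
  induction hf using Submodule.span_induction with
  | zero => exact ⟨0, by simp, by simp⟩
  | add f g _ _ hf hg =>
    obtain ⟨P, hP, hPf⟩ := hf
    obtain ⟨Q, hQ, hQg⟩ := hg
    refine ⟨P + Q, natDegree_add_le_of_degree_le hP hQ, fun k hk => ?_⟩
    simp only [Pi.add_apply, sum_add_distrib, hPf k hk, hQg k hk, eval_add, mul_add]
  | smul c f _ hf =>
    obtain ⟨P, hP, hPf⟩ := hf
    refine ⟨C c * P, (natDegree_C_mul_le c P).trans hP, fun k hk => ?_⟩
    simp only [Pi.smul_apply, smul_eq_mul, ← mul_sum, hPf k hk, eval_mul, eval_C]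
    ring
  | mem f h =>
    obtain ⟨s, hs, rfl⟩ := h
    -- the monomial is `1` at `setOnes y S` iff `S` contains the set `t` of its variables that are
    -- `0` in `y`
    set t := s.filter fun i => y i = false with ht
    have hiff : ∀ S, (∀ i ∈ s, setOnes y S i = true) ↔ t ⊆ S := by
      intro S
      simp only [ht, setOnes, subset_iff, mem_filter]
      refine forall_congr' fun i => ?_
      by_cases h : i ∈ S <;> simp [h]
    simp only [monomialFn, hiff]
    by_cases htB : t ⊆ B
    · have hta : #t ≤ #B := card_le_card htB
      have hpos : (0 : ℝ) < (#B).descFactorial #t := by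
        exact_mod_cast Nat.descFactorial_pos.2 hta
      refine ⟨C ((#B).descFactorial #t : ℝ)⁻¹ * descPochhammer ℝ #t, ?_, fun k hk => ?_⟩
      · refine (natDegree_C_mul_le _ _).trans ?_
        rw [descPochhammer_natDegree]
        exact (card_filter_le _ _).trans hs
      · rw [sum_boole, eval_mul, eval_C, descPochhammer_eval_eq_descFactorial]
        rcases le_or_gt #t k with hk' | hk'
        · rw [card_filter_powersetCard_subset t B k htB hk', mul_left_comm, ← div_eq_inv_mul,
            eq_div_iff hpos.ne']
          norm_cast
          rw [Nat.descFactorial_eq_factorial_mul_choose, Nat.descFactorial_eq_factorial_mul_choose,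
            mul_left_comm ((#B).choose k), Nat.choose_mul hk']
          ring
        · rw [Nat.descFactorial_of_lt hk', filter_false_of_mem]
          · simp
          · intro S hS hS'
            have := card_le_card hS'
            rw [(mem_powersetCard.1 hS).2] at this
            omega
    · refine ⟨0, by simp, fun k _ => ?_⟩
      rw [eval_zero, mul_zero]
      exact sum_eq_zero fun S hS => if_neg fun h => htB (h.trans (mem_powersetCard.1 hS).1)

/-- The overshooting of `exists_two_mul_le_eval`, carried over to the Boolean cube by averaging over
the subsets of `B` of each size. -/
theorem exists_two_mul_le_of_block {d : ℕ} {f : (Fin n → Bool) → ℝ} (hf : f ∈ lowDegree ℝ n d)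
    {y : Fin n → Bool} {B : Finset (Fin n)} (hB : 16 * d ^ 2 + 1 ≤ #B) {M : ℝ} (hM : 0 < M)
    (hy : f y = -M) (hpos : ∀ S ⊆ B, S.Nonempty → 0 ≤ f (setOnes y S)) :
    ∃ S ⊆ B, S.Nonempty ∧ 2 * M ≤ f (setOnes y S) := by
  obtain ⟨P, hP, hPf⟩ := exists_symmetrization hf y B
  have hne : ∀ k, 1 ≤ k → ∀ S ∈ powersetCard k B, S ⊆ B ∧ S.Nonempty := fun k hk S hS =>
    ⟨(mem_powersetCard.1 hS).1, card_pos.1 (by rw [(mem_powersetCard.1 hS).2]; exact hk)⟩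
  have h0 : P.eval 0 = -M := by
    have := hPf 0 (Nat.zero_le _)
    have hy' : setOnes y ∅ = y := by funext i; simp [setOnes]
    simpa [hy', hy] using this.symm
  obtain ⟨k, hk1, hk2, hk⟩ := exists_two_mul_le_eval P hP hM h0 fun k hk1 hk2 => by
    have hc : (0 : ℝ) < (#B).choose k := by exact_mod_cast Nat.choose_pos (hk2.trans hB)
    refine nonneg_of_mul_nonneg_right ?_ hc
    rw [← hPf k (hk2.trans hB)]
    exact sum_nonneg fun S hS => hpos S (hne k hk1 S hS).1 (hne k hk1 S hS).2
  have hkB := hk2.trans hB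
  have hsum : ∑ _S ∈ powersetCard k B, 2 * M ≤ ∑ S ∈ powersetCard k B, f (setOnes y S) := by
    rw [hPf k hkB, sum_const, card_powersetCard, nsmul_eq_mul]
    exact mul_le_mul_of_nonneg_left hk (Nat.cast_nonneg _)
  obtain ⟨S, hS, h⟩ := exists_le_of_sum_le (powersetCard_nonempty.2 hkB) hsum
  exact ⟨S, (hne k hk1 S hS).1, (hne k hk1 S hS).2, h⟩

end LowDegree

/-! ### Margins of low-degree sign representations of ODD-MAX-BIT -/

section Blocks

variable {n : ℕ}

lemma OMB_eq_of_isLast {x : Fin n → Bool} {k : Fin n} (hk : x k = true)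
    (hlast : ∀ i, k < i → x i = false) : OMB n x = decide ((k : ℕ) % 2 = 0) := by
  have h : maxOnePosition x = k + 1 := by
    refine le_antisymm (Finset.sup_le fun i hi => ?_)
      (Finset.le_sup (f := fun i : Fin n => (i : ℕ) + 1) (mem_filter.2 ⟨mem_univ k, hk⟩))
    by_contra hlt
    have hki : k < i := by
      rw [Fin.lt_def]
      omega
    have := (mem_filter.1 hi).2
    rw [hlast i hki] at this
    exact absurd this (by simp)
  rw [OMB, h, decide_eq_decide]
  omega

lemma OMB_zero : OMB n (fun _ => false) = false := by
  simp [OMB, maxOnePosition]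

/-- The sign `+1` or `-1` that a bit stands for. -/
def bitSign (v : Bool) : ℝ := if v then 1 else -1

lemma bitSign_not (v : Bool) : bitSign (!v) = -bitSign v := by
  cases v <;> simp [bitSign]

/-- The indices `i` in the `j`-th interval of length `2 * m` at which a last one would give
ODD-MAX-BIT the value `v`. -/
def parityBlock (n m j : ℕ) (v : Bool) : Finset (Fin n) :=
  univ.filter fun i => 2 * m * j ≤ i ∧ (i : ℕ) < 2 * m * (j + 1) ∧ decide ((i : ℕ) % 2 = 0) = v

lemma le_card_parityBlock {m j : ℕ} (h : 2 * m * (j + 1) ≤ n) (v : Bool) :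
    m ≤ #(parityBlock n m j v) := by
  have hmul : 2 * m * (j + 1) = 2 * (m * j) + 2 * m := by ring
  have hmul' : 2 * m * j = 2 * (m * j) := by ring
  have hlt : ∀ t : Fin m, 2 * m * j + 2 * t + (if v then 0 else 1) < 2 * m * (j + 1) := by
    intro t
    have := t.2
    split_ifs <;> omega
  suffices h' : #(univ : Finset (Fin m)) ≤ #(parityBlock n m j v) by simpa using h'
  refine card_le_card_of_injOn
    (fun t : Fin m => (⟨2 * m * j + 2 * t + (if v then 0 else 1), (hlt t).trans_le h⟩ : Fin n))
    (fun t _ => ?_) (fun a _ b _ hab => ?_)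
  · simp only [parityBlock, coe_filter, mem_univ, true_and, Set.mem_ofPred_eq]
    refine ⟨by omega, hlt t, ?_⟩
    cases v
    · simp; omega
    · simp; omega
  · have := congrArg Fin.val hab
    simp only at this
    exact Fin.ext (by omega)

lemma OMB_setOnes {m j : ℕ} {v : Bool} {y : Fin n → Bool}
    (hy : ∀ i : Fin n, 2 * m * j ≤ i → y i = false) {S : Finset (Fin n)}
    (hS : S ⊆ parityBlock n m j v) (hne : S.Nonempty) : OMB n (setOnes y S) = v := by
  have hmem := (mem_filter.1 (hS (S.max'_mem hne))).2
  rw [OMB_eq_of_isLast (k := S.max' hne), hmem.2.2]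
  · simp [setOnes, S.max'_mem hne]
  · intro i hi
    have hiS : i ∉ S := fun h => absurd (S.le_max' i h) (not_le.2 hi)
    rw [setOnes, if_neg hiS]
    exact hy i (hmem.1.trans (Fin.lt_def.1 hi).le)

/-- A function of degree at most `d` that sign-represents ODD-MAX-BIT with margin `β` has values
exponentially larger than `β`. Cut the indices into intervals of length `2 * (16 * d ^ 2 + 1)`. If
the last one of `y` lies before an interval, then setting bits of that interval with indices of
the right parity flips the value of ODD-MAX-BIT, hence the sign of `f`, and some choice of these
bits at least doubles `|f y|`. -/
theorem two_pow_mul_margin_le {d : ℕ} {f : (Fin n → Bool) → ℝ} (hf : f ∈ lowDegree ℝ n d)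
    {β : ℝ} (hβ : 0 < β) (hfβ : ∀ x, β ≤ bitSign (OMB n x) * f x) {C : ℝ} (hC : ∀ x, |f x| ≤ C) :
    2 ^ (n / (2 * (16 * d ^ 2 + 1))) * β ≤ C := by
  set m := 16 * d ^ 2 + 1 with hm
  have key : ∀ j, 2 * m * j ≤ n → ∃ y : Fin n → Bool, (∀ i : Fin n, 2 * m * j ≤ i → y i = false) ∧
      2 ^ j * β ≤ bitSign (OMB n y) * f y := by
    intro j
    induction j with
    | zero => exact fun _ => ⟨fun _ => false, fun _ _ => rfl, by simpa using hfβ _⟩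
    | succ j ih =>
      intro hj
      obtain ⟨y, hy, hyβ⟩ := ih ((Nat.mul_le_mul_left _ (Nat.le_succ j)).trans hj)
      have hOMB := fun S => @OMB_setOnes n m j (!OMB n y) y hy S
      obtain ⟨S, hSB, hSne, hS⟩ := exists_two_mul_le_of_block
        (f := bitSign (!OMB n y) • f) (y := y) (M := bitSign (OMB n y) * f y)
        ((lowDegree ℝ n d).smul_mem _ hf) (le_card_parityBlock hj (!OMB n y))
        (lt_of_lt_of_le (by positivity) hyβ)
        (by simp [bitSign_not]) (fun S hS hne => by
          have := hfβ (setOnes y S)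
          rw [hOMB S hS hne] at this
          exact hβ.le.trans this)
      refine ⟨setOnes y S, fun i hi => ?_, ?_⟩
      · have hiS : i ∉ S := fun h => by
          have := (mem_filter.1 (hSB h)).2
          omega
        rw [setOnes, if_neg hiS]
        exact hy i ((Nat.mul_le_mul_left _ (Nat.le_succ j)).trans hi)
      · rw [hOMB S hSB hSne, pow_succ]
        simp only [Pi.smul_apply, smul_eq_mul] at hS
        linarith
  obtain ⟨y, -, h⟩ := key (n / (2 * m)) (Nat.mul_div_le n (2 * m))
  refine h.trans ((le_abs_self _).trans ?_)
  rw [abs_mul]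
  have : |bitSign (OMB n y)| = 1 := by unfold bitSign; split_ifs <;> simp
  rw [this, one_mul]
  exact hC y

end Blocks

/-! ### Lower bounds for quantum query algorithms -/

section Algorithms

variable {n : ℕ}

lemma sum_norm_sq_mulVec {ι : Type*} [Fintype ι] [DecidableEq ι] (U : Matrix.unitaryGroup ι ℂ)
    (v : ι → ℂ) : ∑ s, ‖U.1.mulVec v s‖ ^ 2 = ∑ s, ‖v s‖ ^ 2 := by
  have hcast : ∀ w : ι → ℂ, ((∑ s, ‖w s‖ ^ 2 : ℝ) : ℂ) = star w ⬝ᵥ w := by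
    intro w
    rw [dotProduct]
    push_cast
    exact sum_congr rfl fun s _ => (RCLike.conj_mul (w s)).symm
  have h : star (U.1.mulVec v) ⬝ᵥ U.1.mulVec v = star v ⬝ᵥ v := by
    rw [Matrix.star_mulVec, ← Matrix.dotProduct_mulVec, Matrix.mulVec_mulVec,
      ← Matrix.star_eq_conjTranspose, Matrix.mem_unitaryGroup_iff'.1 U.2, Matrix.one_mulVec]
  rw [← hcast, ← hcast] at h
  exact_mod_cast h

lemma sum_norm_sq_queryOracle {m : ℕ} (x : Fin n → Bool) (ψ : QueryBasis n m → ℂ) :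
    ∑ s, ‖queryOracle x ψ s‖ ^ 2 = ∑ s, ‖ψ s‖ ^ 2 := by
  simp only [queryOracle, Fintype.sum_prod_type]
  refine sum_congr rfl fun i _ => ?_
  cases x i <;> simp [add_comm]

lemma sum_norm_sq_state (A : QuantumQueryAlgorithm n) (x : Fin n → Bool) (t : ℕ) :
    ∑ s, ‖A.state x t s‖ ^ 2 = 1 := by
  induction t with
  | zero =>
    rw [QuantumQueryAlgorithm.state, sum_norm_sq_mulVec, sum_eq_single A.start] <;>
      simp +contextual
  | succ t ih => rw [QuantumQueryAlgorithm.state, sum_norm_sq_mulVec, sum_norm_sq_queryOracle, ih]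

lemma outputProb_nonneg (A : QuantumQueryAlgorithm n) (x : Fin n → Bool) (c : Bool) :
    0 ≤ A.outputProb x c :=
  sum_nonneg fun s _ => by split_ifs <;> positivity

lemma outputProb_true_add_false (A : QuantumQueryAlgorithm n) (x : Fin n → Bool) :
    A.outputProb x true + A.outputProb x false = 1 := by
  rw [QuantumQueryAlgorithm.outputProb, QuantumQueryAlgorithm.outputProb, ← sum_add_distrib,
    ← sum_norm_sq_state A x A.queries]
  refine sum_congr rfl fun s _ => ?_
  cases A.output s <;> simp

lemma successProb_le (A : QuantumQueryAlgorithm n) (f : (Fin n → Bool) → Bool) (x : Fin n → Bool) :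
    A.successProb f ≤ A.outputProb x (f x) :=
  ciInf_le (Set.finite_range _).bddBelow x

/-- The polynomial method: each query raises the degree of the amplitudes, as functions of the
input, by at most one. -/
lemma state_mem_lowDegree (A : QuantumQueryAlgorithm n) (t : ℕ) (s : QueryBasis n A.workDim) :
    (fun x => A.state x t s) ∈ lowDegree ℂ n t := by
  induction t generalizing s with
  | zero => exact const_mem_lowDegree 0 _
  | succ t ih =>
    have horacle : ∀ s' : QueryBasis n A.workDim,
        (fun x => queryOracle x (A.state x t) s') ∈ lowDegree ℂ n (t + 1) := by
      rintro ⟨i, b, z⟩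
      have hb : ∀ c, (fun x => A.state x t (i, c, z)) ∈ lowDegree ℂ n t := fun c => ih _
      -- `ψ (i, b ⊕ x i, z) = ψ (i, b, z) + x i * (ψ (i, !b, z) - ψ (i, b, z))`
      have h := (lowDegree ℂ n (t + 1)).add_mem (lowDegree_mono (Nat.le_succ t) (hb b))
        (mul_mem_lowDegree ((lowDegree ℂ n t).sub_mem (hb (!b)) (hb b)) (coord_mem_lowDegree i))
      convert h using 1
      funext x
      cases hx : x i <;> simp [queryOracle, hx]
    have h := (lowDegree ℂ n (t + 1)).sum_mem (t := univ) fun s' _ =>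
      (lowDegree ℂ n (t + 1)).smul_mem ((A.unitary (t + 1)).1 s s') (horacle s')
    convert h using 1
    funext x
    simp [QuantumQueryAlgorithm.state, Matrix.mulVec, dotProduct]

lemma outputProb_mem_lowDegree (A : QuantumQueryAlgorithm n) (c : Bool) :
    (fun x => A.outputProb x c) ∈ lowDegree ℝ n (2 * A.queries) := by
  have h := (lowDegree ℝ n (2 * A.queries)).sum_mem (t := univ)
    fun s _ => (lowDegree ℝ n (2 * A.queries)).smul_mem (if A.output s = c then (1 : ℝ) else 0)
      (norm_sq_mem_lowDegree (state_mem_lowDegree A A.queries s))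
  convert h using 1
  funext x
  simp only [QuantumQueryAlgorithm.outputProb, Finset.sum_apply, Pi.smul_apply, smul_eq_mul,
    ite_mul, one_mul, zero_mul]

lemma OMB_single_zero (hn : 1 ≤ n) : OMB n (fun i => decide (i = ⟨0, hn⟩)) = true := by
  rw [OMB_eq_of_isLast (k := ⟨0, hn⟩) (by simp)]
  · simp
  · intro i hi
    simpa using hi.ne'

/-- Without queries the output distribution is the same for all inputs, while ODD-MAX-BIT is not
constant. -/
lemma queries_pos (hn : 1 ≤ n) (A : QuantumQueryAlgorithm n)
    (hA : 1 / 2 < A.successProb (OMB n)) : 1 ≤ A.queries := by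
  by_contra h
  have h0 : A.queries = 0 := by omega
  have h1 := hA.trans_le (successProb_le A _ (fun _ => false))
  have h2 := hA.trans_le (successProb_le A _ (fun i => decide (i = ⟨0, hn⟩)))
  rw [OMB_zero] at h1
  rw [OMB_single_zero] at h2
  have h3 := outputProb_true_add_false A (fun _ => false)
  have h4 : A.outputProb (fun i => decide (i = ⟨0, hn⟩)) true
      = A.outputProb (fun _ => false) true := by
    simp only [QuantumQueryAlgorithm.outputProb, h0, QuantumQueryAlgorithm.state]
  linarith

theorem two_pow_mul_bias_le (A : QuantumQueryAlgorithm n) (hA : 1 / 2 < A.successProb (OMB n)) :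
    2 ^ (n / (2 * (16 * (2 * A.queries) ^ 2 + 1))) * A.bias (OMB n) ≤ 1 / 2 := by
  have hf := (lowDegree ℝ n (2 * A.queries)).sub_mem (outputProb_mem_lowDegree A true)
    (const_mem_lowDegree _ (1 / 2))
  refine two_pow_mul_margin_le hf (sub_pos.2 hA) (fun x => ?_) fun x => ?_
  · have h1 := successProb_le A (OMB n) x
    have h2 := outputProb_true_add_false A x
    cases hx : OMB n x <;> rw [hx] at h1 <;> simp [bitSign] <;> linarith
  · have h1 := outputProb_true_add_false A x
    have h2 := outputProb_nonneg A x true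
    have h3 := outputProb_nonneg A x false
    rw [abs_le]
    constructor <;> simp <;> linarith

theorem weaklyUnboundedCost_ge (hn : 1 ≤ n) (A : QuantumQueryAlgorithm n)
    (hA : 1 / 2 < A.successProb (OMB n)) :
    1 / 260 * (n : ℝ) ^ (1 / 3 : ℝ) ≤ A.weaklyUnboundedCost (OMB n) := by
  have hT : (1 : ℝ) ≤ A.queries := by exact_mod_cast queries_pos hn A hA
  have hβ : 0 < A.bias (OMB n) := sub_pos.2 hA
  set T := A.queries with hTdef
  set J := n / (2 * (16 * (2 * T) ^ 2 + 1)) with hJ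
  have hlog : (J : ℝ) ≤ Real.logb 2 (1 / (2 * A.bias (OMB n))) := by
    rw [Real.le_logb_iff_rpow_le (by norm_num) (by positivity), Real.rpow_natCast,
      le_div_iff₀ (by positivity)]
    linarith [two_pow_mul_bias_le A hA]
  -- `130 * T ^ 2` bounds the block length `2 * (16 * (2 * T) ^ 2 + 1)` because `T ≥ 1`
  have hJn : (n : ℝ) / (130 * (T : ℝ) ^ 2) ≤ J + 1 := by
    have h1 : n < 2 * (16 * (2 * T) ^ 2 + 1) * (J + 1) := Nat.lt_mul_div_succ n (by positivity)
    have h2 : (n : ℝ) ≤ 2 * (16 * (2 * (T : ℝ)) ^ 2 + 1) * (J + 1) := by exact_mod_cast h1.le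
    rw [div_le_iff₀ (by positivity)]
    have hJ0 : (0 : ℝ) ≤ J := Nat.cast_nonneg J
    nlinarith [mul_nonneg (sub_nonneg.2 (one_le_pow₀ hT : (1 : ℝ) ≤ (T : ℝ) ^ 2))
      (by linarith : (0 : ℝ) ≤ (J : ℝ) + 1)]
  set u := (n : ℝ) ^ (1 / 3 : ℝ) with hu
  have hu0 : 0 ≤ u := by positivity
  have hu3 : u ^ 3 = n := by
    rw [hu, ← Real.rpow_natCast, ← Real.rpow_mul (Nat.cast_nonneg n)]
    norm_num
  -- with `u = n ^ (1 / 3)`, either `T ≥ u`, or `n / T ^ 2 = u ^ 3 / T ^ 2 ≥ u`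
  have hmain : u / 130 ≤ T + n / (130 * (T : ℝ) ^ 2) := by
    rcases le_total u T with h | h
    · have : (0 : ℝ) ≤ n / (130 * (T : ℝ) ^ 2) := by positivity
      linarith
    · have h1 : u / 130 ≤ n / (130 * (T : ℝ) ^ 2) := by
        rw [div_le_div_iff₀ (by norm_num) (by positivity), ← hu3]
        have := mul_le_mul_of_nonneg_left (pow_le_pow_left₀ (by linarith) h 2) hu0
        nlinarith
      linarith
  rw [QuantumQueryAlgorithm.weaklyUnboundedCost]
  -- the term `-1` lost to rounding in `J` is absorbed by `T ≥ 1`, at the cost of a factor `2`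
  have hJ0 : (0 : ℝ) ≤ J := Nat.cast_nonneg J
  linarith

end Algorithms

/-! ### A one-query algorithm for ODD-MAX-BIT -/

section OneQuery

variable {n : ℕ}

lemma exists_unitary_mulVec_single {ι : Type*} [Fintype ι] [DecidableEq ι] (a : ι) {ψ : ι → ℂ}
    (hψ : ∑ s, ‖ψ s‖ ^ 2 = 1) :
    ∃ U : Matrix.unitaryGroup ι ℂ, U.1.mulVec (Pi.single a 1) = ψ := by
  have hnorm : ‖WithLp.toLp 2 ψ‖ = 1 := by
    rw [EuclideanSpace.norm_eq]
    simp [hψ]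
  have horth : Orthonormal ℂ (({a} : Set ι).domRestrict fun _ => WithLp.toLp 2 ψ) := by
    refine ⟨fun i => hnorm, fun i j hij => absurd (Subsingleton.elim i j) hij⟩
  obtain ⟨b, hb⟩ := horth.exists_orthonormalBasis_extension_of_card_eq (by simp)
  refine ⟨⟨_, (EuclideanSpace.basisFun ι ℂ).toMatrix_orthonormalBasis_mem_unitary b⟩, ?_⟩
  funext s
  simp [Module.Basis.toMatrix_apply, hb a rfl]

lemma sum_three_pow (n : ℕ) : ∑ i : Fin n, (3 : ℝ) ^ (i : ℕ) = (3 ^ n - 1) / 2 := by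
  rw [Fin.sum_univ_eq_sum_range (fun i => (3 : ℝ) ^ i), geom_sum_eq (by norm_num)]
  norm_num

lemma exists_isLast (x : Fin n → Bool) :
    x = (fun _ => false) ∨ ∃ k, x k = true ∧ ∀ i, k < i → x i = false := by
  by_cases h : (univ.filter fun i => x i = true).Nonempty
  · right
    refine ⟨_, (mem_filter.1 (max'_mem _ h)).2, fun i hi => ?_⟩
    by_contra hx
    exact absurd (le_max' _ i (mem_filter.2 ⟨mem_univ i, by simpa using hx⟩)) (not_le.2 hi)
  · left
    rw [not_nonempty_iff_eq_empty, filter_eq_empty_iff] at h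
    funext i
    simpa using h (mem_univ i)

/-- The weighted vote behind the one-query algorithm: an index `i` with `x i = 1` votes with weight
`3 ^ i` for the parity it would produce as a last one, an index with `x i = 0` casts a vote for `0`
that is weaker by the factor `3 ^ n`. The vote for the correct value always wins, since the
last one outweighs all smaller indices together. -/
lemma sum_vote_pos (hn : 1 ≤ n) (x : Fin n → Bool) :
    0 < ∑ i : Fin n, (3 : ℝ) ^ (i : ℕ) *
      (if x i = true then (if decide ((i : ℕ) % 2 = 0) = OMB n x then 1 else -1)
        else -bitSign (OMB n x) / 3 ^ n) := by
  have h3n : (0 : ℝ) < 3 ^ n := by positivity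
  rcases exists_isLast x with rfl | ⟨k, hk, hlast⟩
  · rw [OMB_zero]
    refine sum_pos (fun i _ => ?_) ⟨⟨0, hn⟩, mem_univ _⟩
    simp [bitSign]
  · have hO := OMB_eq_of_isLast hk hlast
    set c := OMB n x
    -- the index `k` contributes `3 ^ k`, a smaller index `i` at least `-3 ^ i`, and a larger one at
    -- least `-3 ^ i / 3 ^ n`
    have hle : ∀ i ∈ univ, ((if i = k then (3 : ℝ) ^ (k : ℕ) else 0)
        - (if (i : ℕ) < k then (3 : ℝ) ^ (i : ℕ) else 0) - (3 : ℝ) ^ (i : ℕ) / 3 ^ n) ≤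
        (3 : ℝ) ^ (i : ℕ) * (if x i = true then (if decide ((i : ℕ) % 2 = 0) = c then 1 else -1)
        else -bitSign c / 3 ^ n) := by
      intro i _
      have h3 : (0 : ℝ) < 3 ^ (i : ℕ) := by positivity
      have h3' : (0 : ℝ) < 3 ^ (i : ℕ) / 3 ^ n := by positivity
      have hs : -((3 : ℝ) ^ (i : ℕ) / 3 ^ n) ≤ (3 : ℝ) ^ (i : ℕ) * (-bitSign c / 3 ^ n) := by
        have : (3 : ℝ) ^ (i : ℕ) * (-bitSign c / 3 ^ n)
            = -(bitSign c * ((3 : ℝ) ^ (i : ℕ) / 3 ^ n)) := by ring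
        rw [this]
        unfold bitSign
        split_ifs <;> linarith
      rcases lt_trichotomy i k with h | rfl | h
      · rw [if_neg h.ne, if_pos (Fin.lt_def.1 h)]
        split_ifs <;> linarith
      · rw [if_pos rfl, if_neg (lt_irrefl _), if_pos hk, if_pos hO.symm]
        linarith
      · have : ¬ (i : ℕ) < k := not_lt.2 (Fin.lt_def.1 h).le
        rw [if_neg h.ne', if_neg this, hlast i h, if_neg (by simp)]
        linarith
    refine lt_of_lt_of_le ?_ (sum_le_sum hle)
    have hlow : ∑ i : Fin n, (if (i : ℕ) < k then (3 : ℝ) ^ (i : ℕ) else 0)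
        = (3 ^ (k : ℕ) - 1) / 2 := by
      rw [Fin.sum_univ_eq_sum_range (fun i => if i < (k : ℕ) then (3 : ℝ) ^ i else 0), ← sum_filter]
      have : (range n).filter (· < (k : ℕ)) = range k := by
        ext i
        simp only [mem_filter, mem_range]
        have := k.2
        omega
      rw [this, geom_sum_eq (by norm_num)]
      norm_num
    rw [sum_sub_distrib, sum_sub_distrib, hlow, ← sum_div, sum_three_pow, sum_ite_eq' univ k,
      if_pos (mem_univ k)]
    have h1 : ((3 : ℝ) ^ n - 1) / 2 / 3 ^ n < 1 / 2 := by
      rw [div_lt_iff₀ h3n]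
      linarith
    have h2 : (0 : ℝ) < 3 ^ (k : ℕ) := by positivity
    linarith

/-- The algorithm queries index `i` with probability proportional to `3 ^ i`. On answer `1` it
outputs the value that ODD-MAX-BIT would have with `i` as its last one, and on answer `0` it outputs a coin
slightly biased towards `0`. -/
theorem exists_one_query_algorithm (hn : 1 ≤ n) :
    ∃ A : QuantumQueryAlgorithm n, A.queries = 1 ∧ 1 / 2 < A.successProb (OMB n) := by
  obtain ⟨W, hW⟩ : ∃ W, W = ∑ i : Fin n, (3 : ℝ) ^ (i : ℕ) := ⟨_, rfl⟩
  have hWpos : 0 < W := hW ▸ sum_pos (fun i _ => by positivity) ⟨⟨0, hn⟩, mem_univ _⟩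
  have h3n : (1 : ℝ) ≤ 3 ^ n := one_le_pow₀ (by norm_num)
  have hδ : (1 : ℝ) / 3 ^ n ≤ 1 := (div_le_one (by positivity)).2 h3n
  have hδ0 : (0 : ℝ) < 1 / 3 ^ n := by positivity
  -- the measurement distribution before the query: `i` has probability `3 ^ i / W`, and the coin
  -- `z` prefers `0`, which stands for the output bit `0`, by `3⁻ⁿ`
  set p : QueryBasis n 2 → ℝ := fun s =>
    if s.2.1 = false then 3 ^ (s.1 : ℕ) / W * ((1 + (if s.2.2 = 0 then 1 else -1) / 3 ^ n) / 2)
    else 0 with hp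
  have hp0 : ∀ s, 0 ≤ p s := by
    intro s
    simp only [hp]
    split_ifs
    · positivity
    · refine mul_nonneg (by positivity) ?_
      rw [neg_div]
      linarith
    · exact le_rfl
  have hp1 : ∑ s, ‖((Real.sqrt (p s) : ℝ) : ℂ)‖ ^ 2 = 1 := by
    simp only [Complex.norm_real, Real.norm_eq_abs, sq_abs, Real.sq_sqrt (hp0 _)]
    simp only [hp, Fintype.sum_prod_type, Fintype.sum_bool, Fin.sum_univ_two]
    simp only [reduceCtorEq, if_false, if_true, one_ne_zero, zero_add, add_zero]
    have hsum : ∑ i : Fin n, (3 : ℝ) ^ (i : ℕ) / W = 1 := by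
      rw [← sum_div, ← hW, div_self hWpos.ne']
    refine Eq.trans (sum_congr rfl fun i _ => ?_) hsum
    ring
  set start : QueryBasis n 2 := (⟨0, hn⟩, false, 0)
  obtain ⟨U, hU⟩ := exists_unitary_mulVec_single start hp1
  let A : QuantumQueryAlgorithm n :=
    { workDim := 2
      queries := 1
      start := start
      unitary := fun t => if t = 0 then U else 1
      output := fun s => if s.2.1 = true then decide ((s.1 : ℕ) % 2 = 0) else decide (s.2.2 = 1) }
  have hstate : ∀ x s, ‖A.state x 1 s‖ ^ 2 = p (s.1, xor s.2.1 (x s.1), s.2.2) := by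
    intro x s
    have : A.state x 1 s = ((Real.sqrt (p (s.1, xor s.2.1 (x s.1), s.2.2)) : ℝ) : ℂ) := by
      simp only [QuantumQueryAlgorithm.state, A, if_true, hU]
      simp [queryOracle]
    rw [this, Complex.norm_real, Real.norm_eq_abs, sq_abs, Real.sq_sqrt (hp0 _)]
  have hprob : ∀ x c, A.outputProb x c = 1 / 2 + 1 / (2 * W) * ∑ i : Fin n, (3 : ℝ) ^ (i : ℕ) *
      (if x i = true then (if decide ((i : ℕ) % 2 = 0) = c then 1 else -1)
        else -bitSign c / 3 ^ n) := by
    intro x c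
    have hhalf : (1 : ℝ) / 2 = ∑ i : Fin n, 3 ^ (i : ℕ) / (2 * W) := by
      rw [← sum_div, ← hW]
      field_simp
    rw [hhalf, mul_sum, ← sum_add_distrib, QuantumQueryAlgorithm.outputProb]
    simp only [show A.queries = 1 from rfl]
    simp only [hstate]
    change ∑ s : QueryBasis n 2, _ = _
    rw [Fintype.sum_prod_type]
    refine sum_congr rfl fun i _ => ?_
    rw [Fintype.sum_prod_type]
    simp only [Fintype.sum_bool, Fin.sum_univ_two, A, hp]
    cases x i
    · cases c <;> simp [bitSign] <;> field_simp
    · by_cases hpar : decide ((i : ℕ) % 2 = 0) = c <;> simp [hpar] <;> field_simp <;> ring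
  refine ⟨A, rfl, ?_⟩
  obtain ⟨x, hx⟩ := exists_eq_ciInf_of_finite (f := fun x => A.outputProb x (OMB n x))
  rw [QuantumQueryAlgorithm.successProb, ← hx, hprob]
  have := mul_pos (by positivity : 0 < 1 / (2 * W)) (sum_vote_pos hn x)
  linarith

end OneQuery
end OddMaxBit

theorem mainTheorem9 :
    (∀ n : ℕ, 1 ≤ n → UQ (OMB n) = 1) ∧
      ∃ c : ℝ, 0 < c ∧ ∀ n : ℕ, 2 ≤ n →
        c * ((n : ℝ) ^ (1 / 3 : ℝ) / Real.logb 2 (n : ℝ)) ≤ WUQ (OMB n) := by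
  refine ⟨fun n hn => ?_, 1 / 260, by norm_num, fun n hn => ?_⟩
  · refine le_antisymm (Nat.sInf_le (OddMaxBit.exists_one_query_algorithm hn))
      (le_csInf ⟨1, OddMaxBit.exists_one_query_algorithm hn⟩ ?_)
    rintro _ ⟨A, rfl, hA⟩
    exact OddMaxBit.queries_pos hn A hA
  · obtain ⟨A, -, hA⟩ := OddMaxBit.exists_one_query_algorithm (n := n) (by omega)
    refine le_csInf ⟨_, A, hA, rfl⟩ ?_
    rintro _ ⟨A, hA, rfl⟩
    -- the cost is even of order `n ^ (1 / 3)`: the logarithm only weakens the bound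
    refine le_trans ?_ (OddMaxBit.weaklyUnboundedCost_ge (by omega) A hA)
    have hlog : 1 ≤ Real.logb 2 (n : ℝ) := by
      rw [Real.le_logb_iff_rpow_le (by norm_num) (by positivity), Real.rpow_one]
      exact_mod_cast hn
    exact mul_le_mul_of_nonneg_left (div_le_self (by positivity) hlog) (by norm_num)
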